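/- Let $Y$ be a finite-dimensional Euclidean space, let $K\subseteq Y$ be a nonempty closed convex cone with dual cone $K^*=\{y\in Y : \langle y,x\rangle\ge 0\ \text{for all } x\in K\}$, and let $A:\mathbb{R}^m\to Y$ be a linear operator with adjoint $A^*:Y\to\mathbb{R}^m$. Let $\mathcal{R}(A)\subseteq Y$ be the range of $A$ and $\mathcal{N}(A^*)\subseteq Y$ be the nullspace of $A^*$. For a closed convex cone $C\subseteq Y$ and an integer $r\ge 1$, let $\operatorname{FR}_r(C)$ be the set of all sequences $(y_1,\dots,y_r)\in Y^r$ such that $y_1\in C^*$ and $y_i\in (C\cap y_1^\perp\cap\dots\cap y_{i-1}^\perp)^*$ for $i=2,\dots,r$. Then the set $A^*K^*=\{A^*y : y\in K^*\}$ is not closed if and only if there are integers $k\ge 1$ and $\ell\ge 1$ and sequences $(a_1,\dots,a_{k+1})\in\operatorname{FR}_{k+1}(K^*)$ and $(y_1,\dots,y_{\ell+1})\in\operatorname{FR}_{\ell+1}(K)$ such that $$a_i\in\mathcal{R}(A)\quad (i=1,\dots,k+1),\qquad y_j\in\mathcal{N}(A^*)\quad (j=1,\dots,\ell),$$ and $$\langle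 a_i,y_{\ell+1}\rangle=\begin{cases}0 & \text{if } i\le k,\\ -1 & \text{if } i=k+1.\end{cases}$$ -/

import Mathlib

/-- The order `k` facial reduction cone of a closed convex cone `K`: the sequences
`(y 0, …, y (k - 1))` such that each `y i` lies in the dual cone of
`K ∩ (y 0)ᗮ ∩ … ∩ (y (i - 1))ᗮ`; for `i = 0` this says that `y 0` is in the dual cone of `K`. -/
def FR {Y : Type*} [NormedAddCommGroup Y] [InnerProductSpace ℝ Y]
    [FiniteDimensional ℝ Y]
    (k : ℕ) (K : ProperCone ℝ Y) : Set (Fin k → Y) :=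
  {y | ∀ i : Fin k,
    y i ∈ ProperCone.innerDual {x : Y | x ∈ K ∧ ∀ j : Fin k, j < i → inner ℝ (y j) x = 0}}

/-!
Write `L` for the range of `A`, so that `Lᗮ` is the kernel of the adjoint `A†`. By Farkas' lemma the
closure of `A† K*` is the set of `A† z` with `z` in the dual of `K ∩ L`, while `A† z ∈ A† K*` says
that `z ∈ K* + Lᗮ`. So the image fails to be closed exactly when some `z ∈ (K ∩ L)*` lies outside
`K* + Lᗮ`. The sequence `y` certifies the membership, the sequence `a` the non-membership.

They come from facial reduction (`exists_mem_FR_sub_last_mem`): for a closed convex cone `C` and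
a subspace `M`, each `z ∈ (C ∩ M)*` equals, modulo `Mᗮ`, the last term of a facial reduction
sequence of `C` whose earlier terms lie in `Mᗮ`. Indeed, if every element of `C* ∩ Mᗮ` vanishes on
`C`, then `C* + Mᗮ` is closed, hence equal to `(C ∩ M)*`
(`exists_mem_innerDual_sub_mem_orthogonal`). Otherwise some `b ∈ C* ∩ Mᗮ` does not vanish on `C`;
it starts the sequence, and `C ∩ bᗮ`, which contains `C ∩ M`, spans a smaller space than `C`.

Facial reduction of `K` with `M = L` replaces `z` by the last term `y₀` of a sequence `y` whose
earlier terms lie in `Lᗮ`, with `A† y₀ = A† z`. Let `v ∈ L` satisfy `⟪v, y₀⟫ = -1`, and let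
`M = (L ⊓ y₀ᗮ)ᗮ = Lᗮ + ℝ y₀`. That `y₀ ∉ K* + Lᗮ` says that `v` is nonnegative on `K* ∩ M`, and
facial reduction of `K*` with this `M`, applied to `v`, gives the sequence `a`.

Conversely, the `y` sequence gives `y₀ ∈ (K ∩ L)*` for its last term `y₀`, and the `a` sequence excludes a
`w ∈ K*` with `A† w = A† y₀`, since such a `w` would pair with each `a i` as `y₀` does.
-/

open scoped RealInnerProductSpace

/-! ### Closed images of cones -/

/-- A linear map sends a closed cone to a closed set if it vanishes on the cone only at `0`. -/
theorem isClosed_image_of_forall_eq_zero {E F : Type*} [NormedAddCommGroup E] [NormedSpace ℝ E]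
    [FiniteDimensional ℝ E] [NormedAddCommGroup F] [NormedSpace ℝ F] {S : Set E} (hS : IsClosed S)
    (hcone : ∀ x ∈ S, ∀ c : ℝ, 0 ≤ c → c • x ∈ S) (f : E →L[ℝ] F)
    (hf : ∀ x ∈ S, f x = 0 → x = 0) : IsClosed (f '' S) := by
  have : ProperSpace E := FiniteDimensional.proper ℝ E
  -- By compactness of the unit sphere, `f` is bounded below on the cone.
  obtain ⟨c, hc, hbound⟩ : ∃ c : ℝ, 0 < c ∧ ∀ x ∈ S, c * ‖x‖ ≤ ‖f x‖ := by
    have hcomp : IsCompact (Metric.sphere (0 : E) 1 ∩ S) := (isCompact_sphere 0 1).inter_right hS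
    have hunit : ∀ x ∈ S, x ≠ 0 → ‖x‖⁻¹ • x ∈ Metric.sphere (0 : E) 1 ∩ S := fun x hx h0 =>
      ⟨by simp [norm_smul, h0], hcone x hx _ (by positivity)⟩
    rcases (Metric.sphere (0 : E) 1 ∩ S).eq_empty_or_nonempty with he | hne
    · refine ⟨1, one_pos, fun x hx => ?_⟩
      by_cases h0 : x = 0
      · simp [h0]
      · exact absurd (hunit x hx h0) (by simp [he])
    · obtain ⟨u, hu, hmin⟩ := hcomp.exists_isMinOn hne f.continuous.norm.continuousOn
      have hu0 : u ≠ 0 := by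
        rintro rfl
        simpa using hu.1
      refine ⟨‖f u‖, norm_pos_iff.2 fun h => hu0 (hf u hu.2 h), fun x hx => ?_⟩
      by_cases h0 : x = 0
      · simp [h0]
      · have h := hmin (hunit x hx h0)
        simp only [Set.mem_ofPred_eq, map_smul, norm_smul, norm_inv, norm_norm] at h
        rwa [inv_mul_eq_div, le_div_iff₀ (norm_pos_iff.2 h0)] at h
  refine isClosed_of_closure_subset fun y hy => ?_
  obtain ⟨s, hs, hsy⟩ := mem_closure_iff_seq_limit.1 hy
  choose x hxS hxs using hs
  obtain ⟨R, hR⟩ := (Metric.isBounded_range_of_tendsto s hsy).exists_norm_le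
  have hx : ∀ n, x n ∈ Metric.closedBall (0 : E) (R / c) := fun n => by
    rw [mem_closedBall_zero_iff, le_div_iff₀ hc, mul_comm]
    exact (hbound _ (hxS n)).trans (by simpa [hxs n] using hR (s n) ⟨n, rfl⟩)
  obtain ⟨a, -, φ, hφ, ha⟩ := (isCompact_closedBall (0 : E) (R / c)).tendsto_subseq hx
  refine ⟨a, hS.mem_of_tendsto ha (.of_forall fun n => hxS _), ?_⟩
  refine tendsto_nhds_unique ((f.continuous.tendsto a).comp ha) ?_
  have : f ∘ x ∘ φ = s ∘ φ := funext fun n => hxs _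
  rw [this]
  exact hsy.comp hφ.tendsto_atTop

/-- **Farkas' lemma** for the linear image of a dual cone. -/
theorem mem_closure_image_innerDual_iff {E F : Type*} [NormedAddCommGroup E]
    [InnerProductSpace ℝ E] [FiniteDimensional ℝ E] [NormedAddCommGroup F]
    [InnerProductSpace ℝ F] [FiniteDimensional ℝ F] (C : ProperCone ℝ E) (f : E →ₗ[ℝ] F) (b : F) :
    b ∈ closure (f '' (ProperCone.innerDual (C : Set E) : Set E)) ↔
      ∀ y, LinearMap.adjoint f y ∈ C → 0 ≤ ⟪b, y⟫ := by
  have : CompleteSpace E := FiniteDimensional.complete ℝ E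
  have : CompleteSpace F := FiniteDimensional.complete ℝ F
  have h := ProperCone.relative_hyperplane_separation (C := ProperCone.innerDual (C : Set E))
    (f := LinearMap.toContinuousLinearMap f) (b := b)
  rw [ProperCone.innerDual_innerDual] at h
  exact h

/-- If the elements of `C* ∩ Mᗮ` vanish on `C`, then `(C ∩ M)* = C* + Mᗮ`. -/
theorem exists_mem_innerDual_sub_mem_orthogonal {Y : Type*} [NormedAddCommGroup Y]
    [InnerProductSpace ℝ Y] [FiniteDimensional ℝ Y] (C : ProperCone ℝ Y) (M : Submodule ℝ Y)
    (hCM : ∀ b ∈ ProperCone.innerDual (C : Set Y), b ∈ Mᗮ → ∀ x ∈ C, ⟪b, x⟫ = 0)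
    {z : Y} (hz : ∀ x ∈ C, x ∈ M → 0 ≤ ⟪x, z⟫) :
    ∃ d ∈ ProperCone.innerDual (C : Set Y), z - d ∈ Mᗮ := by
  let f : Y →L[ℝ] Y := M.starProjection
  have hf : ∀ x, f x = 0 ↔ x ∈ Mᗮ := fun x => M.starProjection_apply_eq_zero_iff
  -- `Pᗮ` consists of the elements of `Mᗮ` vanishing on `C`, so that cutting `C*` down to `P`
  -- does not change its projection to `M`.
  let P : Submodule ℝ Y := M ⊔ Submodule.span ℝ (C : Set Y)
  let D : Set Y := {d | d ∈ ProperCone.innerDual (C : Set Y) ∧ d ∈ P}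
  have hfD : IsClosed (f '' D) := by
    refine isClosed_image_of_forall_eq_zero ?_ ?_ f ?_
    · exact (ProperCone.innerDual (C : Set Y)).isClosed.inter P.closed_of_finiteDimensional
    · exact fun x hx c hc => ⟨ProperCone.smul_mem _ hx.1 hc, P.smul_mem c hx.2⟩
    · intro d hd hd0
      have hdM : d ∈ Mᗮ := (hf d).1 hd0
      have hdP : d ∈ Pᗮ := by
        rw [← Submodule.inf_orthogonal]
        refine ⟨hdM, (Submodule.mem_orthogonal _ _).2 fun u hu => ?_⟩
        induction hu using Submodule.span_induction with
        | mem x hx => rw [real_inner_comm]; exact hCM d hd.1 hdM x hx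
        | zero => simp
        | add x y _ _ hx hy => rw [inner_add_left, hx, hy, add_zero]
        | smul c x _ hx => rw [inner_smul_left, hx, mul_zero]
      exact inner_self_eq_zero.1 ((Submodule.mem_orthogonal _ _).1 hdP d hd.2)
  have himage : f '' (ProperCone.innerDual (C : Set Y) : Set Y) = f '' D := by
    refine Set.Subset.antisymm ?_ (Set.image_mono fun d hd => hd.1)
    rintro _ ⟨d, hd, rfl⟩
    have hdP : d - P.starProjection d ∈ Pᗮ := P.sub_starProjection_mem_orthogonal d
    refine ⟨P.starProjection d, ⟨fun x hx => ?_, P.starProjection_apply_mem d⟩, ?_⟩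
    · have h := (Submodule.mem_orthogonal _ _).1 hdP x
        (Submodule.mem_sup_right (Submodule.subset_span hx))
      have h' : 0 ≤ ⟪x, d⟫ := hd hx
      rw [inner_sub_right] at h
      change 0 ≤ ⟪x, P.starProjection d⟫
      linarith
    · have h := (hf _).2 (Submodule.orthogonal_le (le_sup_left : M ≤ P) hdP)
      rw [map_sub, sub_eq_zero] at h
      exact h.symm
  have hfz : f z ∈ closure (f '' (ProperCone.innerDual (C : Set Y) : Set Y)) := by
    refine (mem_closure_image_innerDual_iff C (f : Y →ₗ[ℝ] Y) (f z)).2 fun y hy => ?_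
    have hadj : LinearMap.adjoint (f : Y →ₗ[ℝ] Y) y = f y := by
      refine ext_inner_left ℝ fun x => ?_
      rw [LinearMap.adjoint_inner_right]
      exact M.inner_starProjection_left_eq_right x y
    rw [hadj] at hy
    have h := hz _ hy (M.starProjection_apply_mem y)
    rw [real_inner_comm, ← M.inner_starProjection_left_eq_right y z]
    exact h
  rw [himage, hfD.closure_eq] at hfz
  obtain ⟨d, hd, hdz⟩ := hfz
  exact ⟨d, hd.1, (hf _).1 (by rw [map_sub, hdz, sub_self])⟩

/-! ### Facial reduction -/

theorem mem_FR_iff {Y : Type*} [NormedAddCommGroup Y] [InnerProductSpace ℝ Y]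
    [FiniteDimensional ℝ Y] {k : ℕ} {C : ProperCone ℝ Y} {a : Fin k → Y} :
    a ∈ FR k C ↔
      ∀ i, ∀ x ∈ C, (∀ j < i, ⟪a j, x⟫ = 0) → 0 ≤ ⟪x, a i⟫ :=
  ⟨fun h i _ hx hj => h i ⟨hx, hj⟩, fun h i _ hx => h i _ hx.1 hx.2⟩

theorem cons_mem_FR {Y : Type*} [NormedAddCommGroup Y] [InnerProductSpace ℝ Y]
    [FiniteDimensional ℝ Y] {k : ℕ} {C C' : ProperCone ℝ Y} {b : Y}
    (hb : b ∈ ProperCone.innerDual (C : Set Y)) (hC' : ∀ x ∈ C, ⟪b, x⟫ = 0 → x ∈ C')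
    {a : Fin k → Y} (ha : a ∈ FR k C') : (Fin.cons b a : Fin (k + 1) → Y) ∈ FR (k + 1) C := by
  rw [mem_FR_iff] at ha ⊢
  intro i x hx hj
  cases i using Fin.cases with
  | zero => exact hb hx
  | succ i =>
    have hbx : ⟪b, x⟫ = 0 := hj 0 (Fin.succ_pos i)
    exact ha i x (hC' x hx hbx) fun j hji => hj j.succ (Fin.succ_lt_succ_iff.2 hji)

/-- **Facial reduction**: modulo `Mᗮ`, an element of `(C ∩ M)*` is the last term of a facial
reduction sequence of `C` whose earlier terms lie in `Mᗮ`. As a zero term may always be put in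
front, there can be required to be at least one earlier term. -/
theorem exists_mem_FR_sub_last_mem {Y : Type*} [NormedAddCommGroup Y] [InnerProductSpace ℝ Y]
    [FiniteDimensional ℝ Y] (C : ProperCone ℝ Y) (M : Submodule ℝ Y) {z : Y}
    (hz : ∀ x ∈ C, x ∈ M → 0 ≤ ⟪x, z⟫) :
    ∃ k, 1 ≤ k ∧ ∃ a ∈ FR (k + 1) C, (∀ i : Fin k, a i.castSucc ∈ Mᗮ) ∧ z - a (Fin.last k) ∈ Mᗮ := by
  induction hn : Module.finrank ℝ (Submodule.span ℝ (C : Set Y)) using Nat.strong_induction_on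
    generalizing C with
  | _ n ih =>
    by_cases hCM : ∀ b ∈ ProperCone.innerDual (C : Set Y), b ∈ Mᗮ → ∀ x ∈ C, ⟪b, x⟫ = 0
    · obtain ⟨d, hd, hzd⟩ := exists_mem_innerDual_sub_mem_orthogonal C M hCM hz
      refine ⟨1, le_rfl, Fin.cons 0 fun _ => d, cons_mem_FR (C' := C) (zero_mem _)
        (fun x hx _ => hx) (mem_FR_iff.2 fun _ x hx _ => hd hx), fun i => ?_, hzd⟩
      rw [Subsingleton.elim i 0]
      exact zero_mem _
    · push Not at hCM
      obtain ⟨b, hb, hbM, x₀, hx₀, hbx₀⟩ := hCM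
      let C' : ProperCone ℝ Y := C ⊓ ProperCone.innerDual {-b}
      have hC' : ∀ x ∈ C', ⟪b, x⟫ = 0 := fun x hx => by
        have h1 : 0 ≤ ⟪x, b⟫ := hb hx.1
        have h2 : 0 ≤ ⟪-b, x⟫ := hx.2 rfl
        rw [inner_neg_left] at h2
        rw [real_inner_comm] at h1
        linarith
      have hCb : ∀ x ∈ C, ⟪b, x⟫ = 0 → x ∈ C' := by
        refine fun x hx hbx => ⟨hx, ?_⟩
        rintro _ rfl
        change 0 ≤ ⟪-b, x⟫
        rw [inner_neg_left, hbx, neg_zero]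
      have hlt : Submodule.span ℝ (C' : Set Y) < Submodule.span ℝ (C : Set Y) := by
        refine lt_of_le_of_ne (Submodule.span_mono fun x hx => hx.1) fun h => hbx₀ ?_
        have hle : Submodule.span ℝ (C' : Set Y) ≤ (ℝ ∙ b)ᗮ := Submodule.span_le.2 fun x hx =>
          Submodule.mem_orthogonal_singleton_iff_inner_right.2 (hC' x hx)
        exact Submodule.mem_orthogonal_singleton_iff_inner_right.1
          (hle (h ▸ Submodule.subset_span hx₀))
      obtain ⟨k, -, a, ha, haM, hza⟩ := ih _ (hn ▸ Submodule.finrank_lt_finrank_of_lt hlt) C'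
        (fun x hx hxM => hz x hx.1 hxM) rfl
      refine ⟨k + 1, Nat.le_add_left 1 k, Fin.cons b a, cons_mem_FR hb hCb ha,
        fun i => ?_, hza⟩
      cases i using Fin.cases with
      | zero => exact hbM
      | succ i => exact haM i

/-! ### Non-closedness of the image -/

theorem theorem5 {m : ℕ} {Y : Type*} [NormedAddCommGroup Y] [InnerProductSpace ℝ Y]
    [FiniteDimensional ℝ Y] (K : ProperCone ℝ Y) (A : EuclideanSpace ℝ (Fin m) →ₗ[ℝ] Y) :
    ¬ IsClosed (LinearMap.adjoint A '' (ProperCone.innerDual (K : Set Y) : Set Y)) ↔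
      ∃ k ℓ : ℕ, 1 ≤ k ∧ 1 ≤ ℓ ∧
        ∃ a ∈ FR (k + 1) (ProperCone.innerDual (K : Set Y)), ∃ y ∈ FR (ℓ + 1) K,
          (∀ i : Fin (k + 1), a i ∈ LinearMap.range A) ∧
          (∀ j : Fin ℓ, y j.castSucc ∈ LinearMap.ker (LinearMap.adjoint A)) ∧
          (∀ i : Fin k, inner ℝ (a i.castSucc) (y (Fin.last ℓ)) = 0) ∧
          inner ℝ (a (Fin.last k)) (y (Fin.last ℓ)) = -1 := by
  have hker : LinearMap.ker (LinearMap.adjoint A) = (LinearMap.range A)ᗮ :=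
    (LinearMap.orthogonal_range A).symm
  constructor
  · intro hnc
    obtain ⟨b, hb, hbK⟩ := Set.not_subset.1 (mt isClosed_of_closure_subset hnc)
    -- The range of the adjoint is closed, so the limit point `b` lies in it.
    obtain ⟨z, rfl⟩ : b ∈ LinearMap.range (LinearMap.adjoint A) := by
      rw [← SetLike.mem_coe,
        ← (LinearMap.range (LinearMap.adjoint A)).closed_of_finiteDimensional.closure_eq]
      exact closure_mono (Set.image_subset_range _ _) hb
    rw [mem_closure_image_innerDual_iff, LinearMap.adjoint_adjoint] at hb
    obtain ⟨ℓ, hℓ, y, hy, hyker, hzy⟩ :=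
      exists_mem_FR_sub_last_mem K (LinearMap.range A) (z := z) (by
        rintro _ hx ⟨u, rfl⟩
        rw [real_inner_comm, ← LinearMap.adjoint_inner_left]
        exact hb u hx)
    rw [← hker, LinearMap.mem_ker, map_sub, sub_eq_zero] at hzy
    rw [hzy] at hbK
    set y₀ := y (Fin.last ℓ)
    -- Since `A† y₀ ≠ 0`, some `v` in the range of `A` has `⟪v, y₀⟫ = -1`.
    obtain ⟨v, hvA, hvy⟩ : ∃ v ∈ LinearMap.range A, ⟪v, y₀⟫ = -1 := by
      set q := LinearMap.adjoint A y₀ with hq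
      have hq0 : ⟪q, q⟫ ≠ 0 := fun h => by
        have h0 := inner_self_eq_zero.1 h
        exact hbK ⟨0, zero_mem _, by rw [map_zero, h0]⟩
      refine ⟨A (-(⟪q, q⟫)⁻¹ • q), ⟨_, rfl⟩, ?_⟩
      rw [← LinearMap.adjoint_inner_right, ← hq, real_inner_smul_left, neg_mul,
        inv_mul_cancel₀ hq0]
    let N : Submodule ℝ Y := LinearMap.range A ⊓ (ℝ ∙ y₀)ᗮ
    have hN : ∀ u ∈ N, u ∈ LinearMap.range A ∧ ⟪u, y₀⟫ = 0 := fun u hu =>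
      ⟨hu.1, Submodule.mem_orthogonal_singleton_iff_inner_left.1 hu.2⟩
    obtain ⟨k, hk, a, ha, haN, hva⟩ :=
      exists_mem_FR_sub_last_mem (ProperCone.innerDual (K : Set Y)) Nᗮ (z := v) (by
        intro w hwK hwN
        by_contra! hneg
        -- Rescaled to pair to `-1` with `v`, the element `w` of `Nᗮ` has the same image under
        -- the adjoint as `y₀`.
        have hc : 0 < (-⟪w, v⟫)⁻¹ := inv_pos.2 (neg_pos.2 hneg)
        refine hbK ⟨(-⟪w, v⟫)⁻¹ • w, ProperCone.smul_mem _ hwK hc.le, ?_⟩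
        refine ext_inner_left ℝ fun u => ?_
        rw [LinearMap.adjoint_inner_right, LinearMap.adjoint_inner_right, real_inner_smul_right]
        have hmem : A u + ⟪A u, y₀⟫ • v ∈ N := by
          refine ⟨add_mem ⟨u, rfl⟩ (Submodule.smul_mem _ _ hvA),
            Submodule.mem_orthogonal_singleton_iff_inner_left.2 ?_⟩
          rw [inner_add_left, real_inner_smul_left, hvy]
          ring
        have h := (Submodule.mem_orthogonal _ _).1 hwN _ hmem
        rw [inner_add_left, real_inner_smul_left, real_inner_comm w v] at h
        rw [inv_mul_eq_div, div_eq_iff (neg_pos.2 hneg).ne']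
        linarith)
    rw [Submodule.orthogonal_orthogonal] at haN hva
    refine ⟨k, ℓ, hk, hℓ, a, ha, y, hy, fun i => ?_, fun j => hker ▸ hyker j,
      fun i => (hN _ (haN i)).2, ?_⟩
    · cases i using Fin.lastCases with
      | last => simpa using sub_mem hvA (hN _ hva).1
      | cast i => exact (hN _ (haN i)).1
    · have h := (hN _ hva).2
      rw [inner_sub_left, hvy] at h
      linarith
  · rintro ⟨k, ℓ, -, -, a, ha, y, hy, haA, hyker, hay, hlast⟩ hclosed
    rw [mem_FR_iff] at ha hy
    obtain ⟨w, hwK, hw⟩ : LinearMap.adjoint A (y (Fin.last ℓ)) ∈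
        LinearMap.adjoint A '' (ProperCone.innerDual (K : Set Y) : Set Y) := by
      rw [← hclosed.closure_eq, mem_closure_image_innerDual_iff, LinearMap.adjoint_adjoint]
      intro u hu
      rw [LinearMap.adjoint_inner_left, real_inner_comm]
      refine hy _ _ hu fun j hj => ?_
      have h := hyker (j.castPred hj.ne)
      rw [Fin.castSucc_castPred, LinearMap.mem_ker] at h
      rw [← LinearMap.adjoint_inner_left, h, inner_zero_left]
    have hpair : ∀ i, ⟪a i, w⟫ = ⟪a i, y (Fin.last ℓ)⟫ := fun i => by
      obtain ⟨u, hu⟩ := haA i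
      rw [← hu, ← LinearMap.adjoint_inner_right, hw, LinearMap.adjoint_inner_right]
    have h := ha (Fin.last k) w hwK fun j hj => by
      have h := hay (j.castPred hj.ne)
      rwa [Fin.castSucc_castPred, ← hpair] at h
    rw [real_inner_comm, hpair, hlast] at h
    linarith
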